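/- For $n\ge 0$ let $[n]=\{1,\dots,n\}$ (with $[0]=\emptyset$). A Cayley permutation of $[n]$ is a map $w:[n]\to[n]$ whose image is $[k]$ for some $k\le n$; let $\mathrm{Cay}[n]$ be the set of all of them. Let $\mathrm{des}(w)=|\{i\in[n-1]: w(i)\ge w(i+1)\}|$ be the number of weak descents of $w$ (so $\mathrm{des}(w)=0$ for $n\le 1$), and let $$C_n(t)=\sum_{w\in \mathrm{Cay}[n]}t^{\mathrm{des}(w)}$$ be the $n$-th (weak) Caylerian polynomial. Then, for every $n\ge 0$, $$C_n(t)=\frac{1}{n!}\sum_{k=0}^{n}\begin{bmatrix}n\\k\end{bmatrix}\mathrm{fub}(k)\sum_{i=0}^{k}\begin{Bmatrix}k\\i\end{Bmatrix}\,i!\,(t-1)^{n-i}$$ as polynomials in $t$ with rational coefficients. Here $\begin{bmatrix}n\\k\end{bmatrix}$ is the unsigned Stirling number of the first kind (the number of permutations of $[n]$ with $k$ cycles), $\begin{Bmatrix}k\\i\end{Bmatrix}$ is the Stirling number of the second kind (the number of set partitions of $[k]$ into $i$ blocks), and $\mathrm{fub}(k)$ is the $k$-th Fubini number, i.e. the number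 of ballots (ordered set partitions) of $[k]$: lists of pairwise disjoint nonempty sets with union $[k]$. -/

import Mathlib

namespace Caylerian

/-- A Cayley permutation of `[n]`: a map `w : [n] → [n]` whose image is `[k]` for some `k ≤ n`.
Both copies of `[n] = {1, …, n}` are shifted by one and modelled by `Fin n = {0, …, n - 1}`, so that
`[k]` becomes `{j | j < k}`. -/
def IsCayley {n : ℕ} (w : Fin n → Fin n) : Prop :=
  ∃ k : ℕ, k ≤ n ∧ Finset.univ.image w = Finset.univ.filter (fun j : Fin n => j.val < k)

instance {n : ℕ} : DecidablePred (IsCayley (n := n)) := fun w =>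
  inferInstanceAs (Decidable (∃ k : ℕ, k ≤ n ∧
    Finset.univ.image w = Finset.univ.filter (fun j : Fin n => j.val < k)))

/-- The set of Cayley permutations of `[n]`. -/
def cay (n : ℕ) : Finset (Fin n → Fin n) :=
  Finset.univ.filter IsCayley

/-- The set of weak descents of `w`: positions `i` that have a successor `i + 1` and satisfy
`w (i) ≥ w (i + 1)`. -/
def desSet {n : ℕ} (w : Fin n → Fin n) : Finset (Fin n) :=
  Finset.univ.filter (fun i => ∃ h : i.val + 1 < n, w i ≥ w ⟨i.val + 1, h⟩)

/-- The number of weak descents. -/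
def des {n : ℕ} (w : Fin n → Fin n) : ℕ :=
  (desSet w).card

/-- The `n`-th (weak) Caylerian polynomial. -/
noncomputable def caylerianPoly (n : ℕ) : Polynomial ℚ :=
  ∑ w ∈ cay n, Polynomial.X ^ des w

/-- A ballot (ordered set partition) of `[n]`: a list of pairwise disjoint nonempty blocks whose
union is `[n]`. -/
def IsBallot {n : ℕ} (l : List (Finset (Fin n))) : Prop :=
  (∀ B ∈ l, B.Nonempty) ∧ l.Pairwise Disjoint ∧ ∀ x : Fin n, ∃ B ∈ l, x ∈ B

/-- The `n`-th Fubini number: the number of ballots of `[n]`. -/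
noncomputable def fub (n : ℕ) : ℕ :=
  {l : List (Finset (Fin n)) | IsBallot l}.ncard

/-- There are finitely many ballots, so `fub` is a genuine count. -/
theorem finite_ballots (n : ℕ) : {l : List (Finset (Fin n)) | IsBallot l}.Finite := by
  refine Set.Finite.subset (List.finite_length_le (Finset (Fin n))
    (Fintype.card (Finset (Fin n)))) ?_
  rintro l ⟨hne, hd, -⟩
  refine List.Nodup.length_le_card (List.Pairwise.imp_of_mem ?_ hd)
  rintro a b ha - hab rfl
  exact (hne a ha).ne_empty (disjoint_self.mp hab)

end Caylerian

namespace Caylerian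

open Finset Polynomial

/-! Let W(b, n) enumerate all words of length n over b letters by t^des. Writing each descent weight
t as 1 + (t - 1) cuts a word into weakly decreasing runs, so W(b, n) = ∑ i, [x^n] ((1 - x)^(-b) -
1)^i (t - 1)^(n - i) (`wordPoly_eq_sum_coeff`). These coefficients are polynomials in b with
Stirling coefficients (`factorial_mul_coeff_multisetSeries_pow`), so W(b, n) = ∑ k, b^k c(n, k) with
c(n, k) independent of b. Sorting words by image makes W(·, n) the binomial transform of the
enumerators of surjective words, while b^k is the transform of m! S(k, m). Inverting
(`surjPoly_eq_sum_stirlingWeight`) and summing over m turns b^k into fub(k). -/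

/-- Binomial inversion: the binomial transform of a sequence determines the sequence. -/
theorem eq_of_sum_choose_mul_eq {R : Type*} [CommRing R] {f g : ℕ → R}
    (h : ∀ b, ∑ m ∈ range (b + 1), (b.choose m : R) * f m =
      ∑ m ∈ range (b + 1), (b.choose m : R) * g m) (m : ℕ) : f m = g m := by
  induction m using Nat.strong_induction_on with
  | _ m ih =>
    have hm := h m
    rw [sum_range_succ, sum_range_succ,
      sum_congr rfl fun i hi => by rw [ih i (mem_range.mp hi)]] at hm
    simpa using hm

/-! ### Stirling number identities -/

theorem sum_range_stirlingSecond_mul_descFactorial (a k : ℕ) :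
    ∑ i ∈ range (k + 1), k.stirlingSecond i * a.descFactorial i = a ^ k := by
  induction k with
  | zero => simp
  | succ k ih =>
    rw [sum_range_succ', pow_succ, ← ih, sum_mul]
    have hz : ∀ i, a.descFactorial i * a = a.descFactorial (i + 1) + i * a.descFactorial i := by
      intro i
      rw [Nat.descFactorial_succ]
      rcases le_or_gt i a with hi | hi
      · rw [← add_mul, Nat.sub_add_cancel hi, mul_comm]
      · simp [Nat.descFactorial_eq_zero_iff_lt.mpr hi]
    simp_rw [mul_assoc, hz, mul_add, Nat.stirlingSecond_succ_succ,
      add_mul (_ * Nat.stirlingSecond _ _), sum_add_distrib]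
    rw [Nat.stirlingSecond_succ_zero, zero_mul, add_zero, add_comm]
    congr 1
    -- Shifts the index: the added end terms vanish, by the factor i = 0 and by S(k, k + 1) = 0.
    have h0 := sum_range_succ' (fun i => k.stirlingSecond i * (i * a.descFactorial i)) (k + 1)
    rw [sum_range_succ, Nat.stirlingSecond_eq_zero_of_lt (Nat.lt_succ_self k)] at h0
    simp only [zero_mul, mul_zero, add_zero] at h0
    rw [h0]
    exact sum_congr rfl fun i _ => by ring

theorem sum_range_choose_mul_factorial_mul_stirlingSecond (a k : ℕ) :
    ∑ i ∈ range (a + 1), a.choose i * (i.factorial * k.stirlingSecond i) = a ^ k := by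
  rw [← sum_range_stirlingSecond_mul_descFactorial]
  have h1 : ∀ i, a.choose i * (i.factorial * k.stirlingSecond i) =
      k.stirlingSecond i * a.descFactorial i := fun i => by
    rw [Nat.descFactorial_eq_factorial_mul_choose]; ring
  simp_rw [h1]
  rcases le_total a k with h | h
  · refine sum_subset (range_mono (by lia)) fun i _ hi => ?_
    rw [Nat.descFactorial_eq_zero_iff_lt.mpr (by simpa using hi), mul_zero]
  · refine (sum_subset (range_mono (by lia)) fun i _ hi => ?_).symm
    rw [Nat.stirlingSecond_eq_zero_of_lt (by simpa using hi), zero_mul]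

theorem ascFactorial_eq_sum_stirlingFirst (x n : ℕ) :
    ∑ k ∈ range (n + 1), n.stirlingFirst k * x ^ k = x.ascFactorial n := by
  induction n with
  | zero => simp
  | succ n ih =>
    rw [sum_range_succ', Nat.ascFactorial_succ, ← ih]
    simp_rw [Nat.stirlingFirst_succ_succ, add_mul, sum_add_distrib]
    rw [Nat.stirlingFirst_succ_zero, zero_mul, add_zero, add_comm]
    congr 1
    · rw [mul_sum]
      exact sum_congr rfl fun i _ => by ring
    · have h0 := sum_range_succ' (fun i => n * (n.stirlingFirst i * x ^ i)) (n + 1)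
      rw [sum_range_succ, Nat.stirlingFirst_eq_zero_of_lt (Nat.lt_succ_self n)] at h0
      rw [mul_sum]
      have h1 : n * (n.stirlingFirst 0 * x ^ 0) = 0 := by cases n <;> simp
      rw [h1] at h0
      simp only [zero_mul, mul_zero, add_zero] at h0
      rw [h0]
      exact sum_congr rfl fun i _ => by ring

/-! ### Weak descents of words and decreasing runs -/

/-- The number of weak descents of a word with letters in a linear order. -/
def wordDes {n : ℕ} {α : Type*} [LinearOrder α] (w : Fin n → α) : ℕ :=
  #{i : Fin n | ∃ h : i.val + 1 < n, w ⟨i.val + 1, h⟩ ≤ w i}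

theorem des_eq_wordDes {n : ℕ} (w : Fin n → Fin n) : des w = wordDes w := by
  unfold des desSet wordDes
  congr

theorem wordDes_comp {n : ℕ} {α β : Type*} [LinearOrder α] [LinearOrder β] (e : α ↪o β)
    (w : Fin n → α) : wordDes (fun i => e (w i)) = wordDes w := by
  simp [wordDes]

theorem wordDes_cons_cons {n : ℕ} {α : Type*} [LinearOrder α] (v u : α) (w : Fin n → α) :
    wordDes (Fin.cons v (Fin.cons u w : Fin (n + 1) → α) : Fin (n + 2) → α) =
      (if u ≤ v then 1 else 0) + wordDes (Fin.cons u w : Fin (n + 1) → α) := by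
  unfold wordDes
  rw [card_filter, Fin.sum_univ_succ, card_filter]
  congr 1
  · congr 1
    simp only [Fin.val_zero, eq_iff_iff]
    constructor
    · rintro ⟨_, h⟩; exact h
    · intro h; exact ⟨by lia, by simpa using h⟩
  · refine sum_congr rfl fun i _ => ?_
    congr 1
    simp only [Fin.val_succ, eq_iff_iff]
    constructor
    · rintro ⟨h, h'⟩; exact ⟨by lia, h'⟩
    · rintro ⟨h, h'⟩; exact ⟨by lia, h'⟩

theorem wordDes_of_le_one {n : ℕ} {α : Type*} [LinearOrder α] (hn : n ≤ 1) (w : Fin n → α) :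
    wordDes w = 0 := by
  rw [wordDes, card_eq_zero, filter_eq_empty_iff]
  rintro i - ⟨h, -⟩
  lia

/-- The weak descent enumerator of the words of length `n` over the alphabet `Fin b`. -/
noncomputable def wordPoly (b n : ℕ) : ℚ[X] :=
  ∑ w : Fin n → Fin b, X ^ wordDes w

/-- The weak descent enumerator of the words of length `n + 1` with first letter `v`. -/
noncomputable def wordPolyFrom (b n : ℕ) (v : Fin b) : ℚ[X] :=
  ∑ w : Fin n → Fin b, X ^ wordDes (Fin.cons v w : Fin (n + 1) → Fin b)

theorem sum_fun_fin_succ {M : Type*} [AddCommMonoid M] {b n : ℕ} (f : (Fin (n + 1) → Fin b) → M) :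
    ∑ w, f w = ∑ v : Fin b, ∑ w : Fin n → Fin b, f (Fin.cons v w) := by
  rw [← Fintype.sum_prod_type']
  exact (Fintype.sum_equiv (Fin.consEquiv fun _ => Fin b) _ _ fun _ => rfl).symm

theorem wordPoly_zero (b : ℕ) : wordPoly b 0 = 1 := by
  simp [wordPoly, wordDes]

theorem wordPoly_succ (b n : ℕ) : wordPoly b (n + 1) = ∑ v, wordPolyFrom b n v :=
  sum_fun_fin_succ _

theorem wordPolyFrom_zero (b : ℕ) (v : Fin b) : wordPolyFrom b 0 v = 1 := by
  simp [wordPolyFrom, wordDes_of_le_one]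

/-- The first adjacency contributes 1 + (t - 1)[u ≤ v], where u is the second letter. -/
theorem wordPolyFrom_succ (b n : ℕ) (v : Fin b) :
    wordPolyFrom b (n + 1) v =
      wordPoly b (n + 1) + (X - 1) * ∑ u, if u ≤ v then wordPolyFrom b n u else 0 := by
  rw [wordPolyFrom, sum_fun_fin_succ, wordPoly_succ, mul_sum, ← sum_add_distrib]
  refine sum_congr rfl fun u _ => ?_
  simp_rw [wordDes_cons_cons, pow_add, ← mul_sum]
  rw [← wordPolyFrom]
  split_ifs <;> ring

/-- The number of weakly decreasing words of length `j + 1` over `Fin b` with last letter `v`. -/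
def decCount (b : ℕ) : ℕ → Fin b → ℕ
  | 0, _ => 1
  | j + 1, v => ∑ u, if v ≤ u then decCount b j u else 0

theorem decCount_eq_choose (b j : ℕ) (v : Fin b) :
    decCount b j v = (b - 1 - v + j).choose j := by
  induction j generalizing v with
  | zero => simp [decCount]
  | succ j ih =>
    simp_rw [decCount, ih]
    have h1 : (∑ u : Fin b, if v ≤ u then (b - 1 - u + j).choose j else 0) =
        ∑ u ∈ range b, if v.val ≤ u then (b - 1 - u + j).choose j else 0 :=
      Fin.sum_univ_eq_sum_range (fun u => if v.val ≤ u then (b - 1 - u + j).choose j else 0) b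
    rw [h1, ← sum_range_reflect, ← add_assoc, ← Nat.sum_range_add_choose,
      ← sum_filter]
    refine sum_congr ?_ ?_
    · ext x
      simp only [mem_filter, mem_range]
      lia
    · intro x hx
      rw [mem_range] at hx
      congr 2
      lia

/-- A weakly decreasing word extends uniquely by the least letter 0, so the total is a single value
of `decCount` at `j + 1`. -/
theorem sum_decCount (b j : ℕ) : ∑ v, decCount (b + 1) j v = (b + (j + 1)).choose b := by
  have h : decCount (b + 1) (j + 1) 0 = ∑ v, decCount (b + 1) j v := by simp [decCount]
  rw [← h, decCount_eq_choose, Nat.choose_symm_add]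
  simp

/-- A run of length j + 1 ending in v either stops, leaving a free word, or takes one more letter at
the cost of a factor t - 1. The general j is what the induction needs; j = 0 gives the recurrence.
-/
theorem sum_decCount_mul_wordPolyFrom (b j n : ℕ) :
    ∑ v, (decCount b j v : ℚ[X]) * wordPolyFrom b n v =
      ∑ i ∈ range (n + 1),
        (X - 1) ^ i * ((∑ v, decCount b (j + i) v : ℕ) : ℚ[X]) * wordPoly b (n - i) := by
  induction n generalizing j with
  | zero => simp [wordPolyFrom_zero, wordPoly_zero]
  | succ n ih =>
    simp_rw [wordPolyFrom_succ, mul_add, sum_add_distrib]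
    rw [← sum_mul, sum_range_succ', add_comm]
    congr 1
    · have h1 : ∑ v, (decCount b j v : ℚ[X]) * ((X - 1) *
          ∑ u, if u ≤ v then wordPolyFrom b n u else 0) =
          (X - 1) * ∑ v, (decCount b (j + 1) v : ℚ[X]) * wordPolyFrom b n v := by
        simp_rw [show ∀ v, decCount b (j + 1) v = ∑ u, if v ≤ u then decCount b j u else 0 from
          fun _ => rfl, Nat.cast_sum, mul_sum, sum_mul, mul_sum]
        rw [sum_comm]
        refine sum_congr rfl fun u _ => sum_congr rfl fun v _ => ?_
        split_ifs <;> push_cast <;> ring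
      rw [h1, ih, mul_sum]
      refine sum_congr rfl fun i _ => ?_
      rw [Nat.add_sub_add_right, pow_succ, show j + 1 + i = j + (i + 1) by lia]
      ring
    · simp

theorem wordPoly_succ_eq_sum (b n : ℕ) :
    wordPoly b (n + 1) = ∑ i ∈ range (n + 1),
      (X - 1) ^ i * ((∑ v, decCount b i v : ℕ) : ℚ[X]) * wordPoly b (n - i) := by
  have h := sum_decCount_mul_wordPolyFrom b 0 n
  simpa [wordPoly_succ, decCount] using h

/-! ### Generating function of runs -/

/-- The power series `(1 - X)⁻ᵇ - 1`. -/
noncomputable def multisetSeries (b : ℕ) : PowerSeries ℚ :=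
  (PowerSeries.invOneSubPow ℚ b).val - 1

theorem coeff_succ_multisetSeries (b j : ℕ) :
    PowerSeries.coeff (j + 1) (multisetSeries b) = (∑ v, decCount b j v : ℕ) := by
  cases b with
  | zero => simp [multisetSeries, PowerSeries.invOneSubPow_zero]
  | succ b =>
    rw [sum_decCount, multisetSeries, PowerSeries.invOneSubPow_val_succ_eq_mk_add_choose]
    simp [PowerSeries.coeff_one]

theorem coeff_zero_multisetSeries (b : ℕ) : PowerSeries.coeff 0 (multisetSeries b) = 0 := by
  cases b with
  | zero => simp [multisetSeries, PowerSeries.invOneSubPow_zero]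
  | succ b =>
    rw [multisetSeries, PowerSeries.invOneSubPow_val_succ_eq_mk_add_choose, map_sub,
      PowerSeries.coeff_mk]
    simp

theorem coeff_multisetSeries_pow_eq_zero {b n i : ℕ} (h : n < i) :
    PowerSeries.coeff n (multisetSeries b ^ i) = 0 := by
  have hX : PowerSeries.X ∣ multisetSeries b := by
    rw [PowerSeries.X_dvd_iff, ← PowerSeries.coeff_zero_eq_constantCoeff_apply]
    exact coeff_zero_multisetSeries b
  exact PowerSeries.X_pow_dvd_iff.mp (pow_dvd_pow_of_dvd hX i) n h

theorem coeff_succ_multisetSeries_pow_succ (b n i : ℕ) :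
    PowerSeries.coeff (n + 1) (multisetSeries b ^ (i + 1)) =
      ∑ j ∈ range (n + 1), ((∑ v, decCount b j v : ℕ) : ℚ) *
        PowerSeries.coeff (n - j) (multisetSeries b ^ i) := by
  rw [pow_succ', PowerSeries.coeff_mul, Nat.sum_antidiagonal_succ, coeff_zero_multisetSeries,
    zero_mul, zero_add, Nat.sum_antidiagonal_eq_sum_range_succ_mk]
  simp_rw [coeff_succ_multisetSeries]

/-- Iterates the recurrence: i is the number of runs, and n - i the number of adjacencies inside
runs. -/
theorem wordPoly_eq_sum_coeff (b n : ℕ) :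
    wordPoly b n = ∑ i ∈ range (n + 1),
      C (PowerSeries.coeff n (multisetSeries b ^ i)) * (X - 1) ^ (n - i) := by
  induction n using Nat.strong_induction_on with
  | _ n ih =>
    cases n with
    | zero => simp [wordPoly_zero]
    | succ n =>
      rw [wordPoly_succ_eq_sum, sum_range_succ' _ (n + 1)]
      simp_rw [coeff_succ_multisetSeries_pow_succ, map_sum, sum_mul]
      rw [sum_comm]
      simp only [pow_zero, PowerSeries.coeff_one, Nat.succ_ne_zero, if_false, map_zero, zero_mul,
        add_zero]
      refine sum_congr rfl fun j hj => ?_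
      rw [mem_range] at hj
      rw [ih (n - j) (by lia), mul_sum]
      -- The remaining n - j letters form at most n - j runs, so the sum may be padded with zeros.
      refine (sum_congr rfl fun i hi => ?_).trans
        (sum_subset (range_mono (by lia : n - j + 1 ≤ n + 1)) fun i _ hi => ?_)
      · rw [mem_range] at hi
        rw [show n + 1 - (i + 1) = j + (n - j - i) by lia, pow_add, map_mul, map_natCast]
        ring
      · rw [coeff_multisetSeries_pow_eq_zero (by simpa using hi)]
        simp

theorem factorial_mul_coeff_invOneSubPow (d n : ℕ) :
    (n.factorial : ℚ) * PowerSeries.coeff n (PowerSeries.invOneSubPow ℚ d).val =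
      d.ascFactorial n := by
  cases d with
  | zero =>
    cases n with
    | zero => simp [PowerSeries.invOneSubPow_zero]
    | succ n => simp [PowerSeries.invOneSubPow_zero, PowerSeries.coeff_one, Nat.zero_ascFactorial]
  | succ d =>
    rw [PowerSeries.invOneSubPow_val_succ_eq_mk_add_choose, PowerSeries.coeff_mk,
      Nat.ascFactorial_eq_factorial_mul_choose, Nat.choose_symm_add]
    push_cast
    rfl

theorem invOneSubPow_pow (b a : ℕ) :
    (PowerSeries.invOneSubPow ℚ b).val ^ a = (PowerSeries.invOneSubPow ℚ (b * a)).val := by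
  simp_rw [PowerSeries.invOneSubPow_eq_inv_one_sub_pow, ← Units.val_pow_eq_pow_val, ← pow_mul]

/-- Binomial inversion in i: at a, both transforms equal n! [x^n] (1 - x)^(-ab), the rising
factorial of ab. -/
theorem factorial_mul_coeff_multisetSeries_pow (b n i : ℕ) :
    (n.factorial : ℚ) * PowerSeries.coeff n (multisetSeries b ^ i) =
      ∑ k ∈ range (n + 1),
        (n.stirlingFirst k : ℚ) * b ^ k * (i.factorial * k.stirlingSecond i) := by
  revert i
  refine eq_of_sum_choose_mul_eq fun a => ?_
  trans ((b * a).ascFactorial n : ℚ)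
  · rw [← factorial_mul_coeff_invOneSubPow, ← invOneSubPow_pow,
      ← sub_add_cancel (PowerSeries.invOneSubPow ℚ b).val 1, ← multisetSeries, add_pow, map_sum,
      mul_sum]
    refine sum_congr rfl fun i _ => ?_
    rw [one_pow, mul_one, ← map_natCast (PowerSeries.C (R := ℚ)), PowerSeries.coeff_mul_C]
    ring
  · simp_rw [mul_sum]
    rw [sum_comm, ← ascFactorial_eq_sum_stirlingFirst, Nat.cast_sum]
    refine sum_congr rfl fun k _ => ?_
    rw [mul_pow, ← sum_range_choose_mul_factorial_mul_stirlingSecond a k]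
    push_cast
    rw [mul_sum, mul_sum]
    exact sum_congr rfl fun i _ => by ring

/-! ### Surjective words and Cayley permutations -/

/-- The weak descent enumerator of the surjective words of length `n` over `Fin m`. -/
noncomputable def surjPoly (m n : ℕ) : ℚ[X] :=
  ∑ w : Fin n → Fin m with Function.Surjective w, X ^ wordDes w

theorem sum_image_eq_surjPoly {b n : ℕ} (T : Finset (Fin b)) :
    ∑ w : Fin n → Fin b with univ.image w = T, (X : ℚ[X]) ^ wordDes w = surjPoly #T n := by
  symm
  refine sum_nbij (fun w i => T.orderEmbOfFin rfl (w i)) ?_ ?_ ?_ ?_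
  · intro w hw
    simp only [mem_filter, mem_univ, true_and] at hw ⊢
    rw [← coe_inj, coe_image, coe_univ, Set.image_univ, ← range_orderEmbOfFin T rfl]
    exact hw.range_comp _
  · intro w _ w' _ h
    funext i
    exact (T.orderEmbOfFin rfl).injective (congrFun h i)
  · intro w hw
    simp only [coe_filter, mem_univ, true_and, Set.mem_ofPred_eq] at hw
    have hT : ∀ i, ∃ j, T.orderEmbOfFin rfl j = w i := fun i => by
      rw [← Set.mem_range, range_orderEmbOfFin, ← hw]
      simp
    choose v hv using hT
    refine ⟨v, ?_, funext hv⟩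
    simp only [coe_filter, mem_univ, true_and, Set.mem_ofPred_eq]
    intro j
    have hj : T.orderEmbOfFin rfl j ∈ univ.image w := hw ▸ orderEmbOfFin_mem T rfl j
    obtain ⟨i, -, hi⟩ := mem_image.mp hj
    exact ⟨i, (T.orderEmbOfFin rfl).injective ((hv i).trans hi)⟩
  · intro w _
    rw [wordDes_comp]

theorem wordPoly_eq_sum_surjPoly (b n : ℕ) :
    wordPoly b n = ∑ m ∈ range (b + 1), (b.choose m : ℚ[X]) * surjPoly m n := by
  rw [wordPoly, ← sum_fiberwise univ (fun w : Fin n → Fin b => univ.image w)]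
  simp_rw [sum_image_eq_surjPoly]
  rw [← powerset_univ, sum_powerset_apply_card (fun m => surjPoly m n)]
  simp

theorem caylerianPoly_eq_sum_surjPoly (n : ℕ) :
    caylerianPoly n = ∑ m ∈ range (n + 1), surjPoly m n := by
  have hcard : ∀ k ≤ n, #{j : Fin n | j.val < k} = k := fun k hk => by
    rw [Fin.card_filter_val_lt, min_eq_right hk]
  have hcay : cay n = (range (n + 1)).biUnion fun k =>
      {w : Fin n → Fin n | univ.image w = ({j : Fin n | j.val < k} : Finset (Fin n))} := by
    ext w
    simp [cay, IsCayley]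
  rw [caylerianPoly, hcay, sum_biUnion]
  · refine sum_congr rfl fun k hk => ?_
    simp_rw [des_eq_wordDes]
    rw [sum_image_eq_surjPoly, hcard k (Nat.lt_succ_iff.mp (mem_range.mp hk))]
  · intro k hk l hl hkl
    rw [Function.onFun, disjoint_left]
    intro w hw hw'
    rw [mem_coe, mem_range, Nat.lt_succ_iff] at hk hl
    rw [mem_filter] at hw hw'
    exact hkl (by rw [← hcard k hk, ← hcard l hl, ← hw.2, ← hw'.2])

theorem card_surjective (k m : ℕ) :
    #{w : Fin k → Fin m | Function.Surjective w} = m.factorial * k.stirlingSecond m := by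
  have hz : ((#{w : Fin k → Fin m | Function.Surjective w} : ℕ) : ℚ) =
      (m.factorial * k.stirlingSecond m : ℕ) := by
    revert m
    refine eq_of_sum_choose_mul_eq fun b => ?_
    -- At t = 1 the enumerators become plain counts, and W(b, k) becomes b^k.
    have h := congrArg (Polynomial.eval 1) (wordPoly_eq_sum_surjPoly b k)
    simp only [wordPoly, surjPoly, eval_finsetSum, eval_mul, eval_natCast, eval_pow, eval_X,
      one_pow, sum_const, nsmul_eq_mul, mul_one, card_univ, Fintype.card_fun, Fintype.card_fin] at h
    rw [← h, ← sum_range_choose_mul_factorial_mul_stirlingSecond]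
    push_cast
    rfl
  exact_mod_cast hz

/-! ### Ballots as surjections -/

/-- The list of fibres of a word over `Fin m`. -/
def fibreList {k : ℕ} (p : Σ m, Fin k → Fin m) : List (Finset (Fin k)) :=
  List.ofFn fun j => univ.filter fun x => p.2 x = j

theorem fibreList_injective (k : ℕ) : Function.Injective (fibreList (k := k)) := by
  rintro ⟨m, f⟩ ⟨m', f'⟩ h
  obtain rfl : m = m' := by simpa [fibreList] using congrArg List.length h
  have h' := List.ofFn_injective h
  congr
  funext x
  have hx : x ∈ ({y | f' y = f x} : Finset (Fin k)) := by
    rw [← congrFun h' (f x)]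
    simp
  simpa using (mem_filter.mp hx).2.symm

theorem isBallot_iff_exists_fibreList {k : ℕ} (l : List (Finset (Fin k))) :
    IsBallot l ↔ ∃ p : Σ m, Fin k → Fin m, Function.Surjective p.2 ∧ fibreList p = l := by
  constructor
  · rintro ⟨hne, hd, hc⟩
    have hidx : ∀ x, ∃ i : Fin l.length, x ∈ l.get i := fun x => by
      obtain ⟨B, hB, hx⟩ := hc x
      obtain ⟨i, rfl⟩ := List.mem_iff_get.mp hB
      exact ⟨i, hx⟩
    choose f hf using hidx
    have huniq : ∀ x j, x ∈ l.get j → f x = j := fun x j hx => by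
      by_contra hne'
      rw [List.pairwise_iff_get] at hd
      rcases lt_or_gt_of_ne hne' with hlt | hlt
      · exact disjoint_left.mp (hd _ _ hlt) (hf x) hx
      · exact disjoint_left.mp (hd _ _ hlt) hx (hf x)
    refine ⟨⟨l.length, f⟩, fun j => ?_, ?_⟩
    · obtain ⟨x, hx⟩ := hne _ (List.get_mem l j)
      exact ⟨x, huniq x j hx⟩
    · rw [fibreList]
      conv_rhs => rw [← List.ofFn_get l]
      congr 1
      funext j
      ext x
      simp only [mem_filter, mem_univ, true_and]
      exact ⟨fun h => h ▸ hf x, huniq x j⟩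
  · rintro ⟨⟨m, f⟩, hs, rfl⟩
    refine ⟨?_, ?_, fun x => ?_⟩
    · intro B hB
      obtain ⟨j, rfl⟩ := (List.mem_ofFn' _ _).mp hB
      obtain ⟨x, hx⟩ := hs j
      exact ⟨x, by simpa using hx⟩
    · rw [fibreList, List.pairwise_ofFn]
      intro i j hij
      rw [disjoint_left]
      intro x hx hx'
      simp only [mem_filter, mem_univ, true_and] at hx hx'
      exact hij.ne (hx.symm.trans hx')
    · exact ⟨_, (List.mem_ofFn' _ _).mpr ⟨f x, rfl⟩, by simp⟩

theorem fub_eq_sum (k : ℕ) :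
    fub k = ∑ m ∈ range (k + 1), m.factorial * k.stirlingSecond m := by
  have hset : {l : List (Finset (Fin k)) | IsBallot l} =
      (((range (k + 1)).sigma fun m => {w : Fin k → Fin m | Function.Surjective w}).map
        ⟨fibreList, fibreList_injective k⟩ : Finset (List (Finset (Fin k)))) := by
    ext l
    rw [Set.mem_ofPred_eq, isBallot_iff_exists_fibreList, mem_coe, mem_map]
    refine exists_congr fun p => and_congr_left fun _ => ?_
    rw [mem_sigma, mem_filter, mem_range, Nat.lt_succ_iff]
    refine ⟨fun h => ⟨?_, mem_univ _, h⟩, fun h => h.2.2⟩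
    -- A surjection from k points has at most k fibres, which bounds the range of m.
    simpa using Fintype.card_le_of_surjective _ h
  rw [fub, hset, Set.ncard_coe_finset, card_map, card_sigma]
  exact sum_congr rfl fun m _ => card_surjective k m

/-! ### Inversion in the alphabet size -/

/-- The weight attached to `k`, independently of the alphabet, in the expansion of the word
enumerators. -/
noncomputable def stirlingWeight (n k : ℕ) : ℚ[X] :=
  C (1 / (n.factorial : ℚ)) * ((n.stirlingFirst k : ℚ[X]) *
    ∑ i ∈ range (k + 1),
      (k.stirlingSecond i : ℚ[X]) * (i.factorial : ℚ[X]) * (X - 1) ^ (n - i))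

theorem wordPoly_eq_sum_stirlingWeight (b n : ℕ) :
    wordPoly b n = ∑ k ∈ range (n + 1), (b : ℚ[X]) ^ k * stirlingWeight n k := by
  have hn : (n.factorial : ℚ) ≠ 0 := by positivity
  have hc : ∀ i, PowerSeries.coeff n (multisetSeries b ^ i) = 1 / (n.factorial : ℚ) *
      ∑ k ∈ range (n + 1),
        (n.stirlingFirst k : ℚ) * b ^ k * (i.factorial * k.stirlingSecond i) := fun i => by
    rw [← factorial_mul_coeff_multisetSeries_pow]
    field_simp
  simp_rw [wordPoly_eq_sum_coeff, hc, map_mul, map_sum, mul_sum, sum_mul]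
  rw [sum_comm]
  refine sum_congr rfl fun k hk => ?_
  rw [stirlingWeight, mul_sum, mul_sum, mul_sum]
  rw [mem_range] at hk
  refine (sum_subset (range_mono (by lia : k + 1 ≤ n + 1)) fun i _ hi => ?_).symm.trans
    (sum_congr rfl fun i _ => ?_)
  · rw [Nat.stirlingSecond_eq_zero_of_lt (by simpa using hi)]
    simp
  · simp only [map_mul, map_pow, map_natCast]
    ring

theorem surjPoly_eq_sum_stirlingWeight (m n : ℕ) :
    surjPoly m n = ∑ k ∈ range (n + 1),
      ((m.factorial * k.stirlingSecond m : ℕ) : ℚ[X]) * stirlingWeight n k := by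
  revert m
  refine eq_of_sum_choose_mul_eq fun b => ?_
  rw [← wordPoly_eq_sum_surjPoly, wordPoly_eq_sum_stirlingWeight]
  simp_rw [mul_sum]
  rw [sum_comm]
  refine sum_congr rfl fun k _ => ?_
  rw [← Nat.cast_pow, ← sum_range_choose_mul_factorial_mul_stirlingSecond b k, Nat.cast_sum,
    sum_mul]
  exact sum_congr rfl fun m _ => by rw [Nat.cast_mul, mul_assoc]

end Caylerian

/-- Here `Nat.stirlingFirst` and `Nat.stirlingSecond` are the unsigned Stirling numbers of the first
kind and the Stirling numbers of the second kind. -/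
theorem mainTheorem1 (n : ℕ) :
    Caylerian.caylerianPoly n =
      Polynomial.C (1 / (n.factorial : ℚ)) *
        ∑ k ∈ Finset.range (n + 1),
          (Nat.stirlingFirst n k : Polynomial ℚ) * (Caylerian.fub k : Polynomial ℚ) *
            ∑ i ∈ Finset.range (k + 1),
              (Nat.stirlingSecond k i : Polynomial ℚ) * (i.factorial : Polynomial ℚ) *
                (Polynomial.X - 1) ^ (n - i) := by
  rw [Caylerian.caylerianPoly_eq_sum_surjPoly]
  simp_rw [Caylerian.surjPoly_eq_sum_stirlingWeight]
  rw [Finset.sum_comm, Finset.mul_sum]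
  refine Finset.sum_congr rfl fun k hk => ?_
  rw [Finset.mem_range] at hk
  have hfub : Caylerian.fub k =
      ∑ m ∈ Finset.range (n + 1), m.factorial * k.stirlingSecond m := by
    rw [Caylerian.fub_eq_sum]
    refine Finset.sum_subset (Finset.range_mono (by lia)) fun m _ hm => ?_
    rw [Nat.stirlingSecond_eq_zero_of_lt (by simpa using hm), mul_zero]
  rw [← Finset.sum_mul, ← Nat.cast_sum, ← hfub, Caylerian.stirlingWeight]
  ring
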